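/- Theorem 3.3 (two well-separated targets). Let $\Omega=\{x\in\mathbb R^2:|x|<1\}$ be the unit disk and $x(t)=(\cos t,\sin t)$. For $s_1,s_2\in\mathbb R$ and $\varepsilon_1,\varepsilon_2>0$ let $\partial\Omega_i=\{x(t): s_i-\varepsilon_i<t<s_i+\varepsilon_i\}$, $i=1,2$, $\partial\Omega_a=\partial\Omega_1\cup\partial\Omega_2$ (the absorbing part) and $\partial\Omega_r=\partial\Omega\setminus\overline{\partial\Omega_a}$ (the reflecting part). A solution is a function $u\in C^2(\Omega)\cap C(\overline\Omega)$ with $$\Delta u=-1\ \text{in }\Omega,\qquad u=0\ \text{on }\partial\Omega_a,\qquad \frac{\partial u}{\partial\nu}=0\ \text{on }\partial\Omega_r,$$ where $\nu$ is the outward unit normal and the normal derivative is the one-sided derivative from inside $\Omega$. For every $c_0>0$ there is $\varepsilon_0>0$ such that for every $c>0$ there is a constant $K$ (depending only on $c_0$ and $c$) with the following property. Let $0<\varepsilon_1,\varepsilon_2<\varepsilon_0$, let $s_1,s_2$ satisfy $d:=|x(s_1)-x(s_2)|\ge c_0$, and let $u$ be the solution. Then $$u(x)=\frac{(\ln d)^2-\ln\frac{\varepsilon_1}{2}\ln\frac{\varepsilon_2}{2}}{\ln\frac{\varepsilon_1\varepsilon_2}{4d^2}}+\frac14(1-|x|^2)+\frac{\ln\frac{\varepsilon_2}{2d}}{\ln\frac{\varepsilon_1\varepsilon_2}{4d^2}}\ln|x-x(s_1)|+\frac{\ln\frac{\varepsilon_1}{2d}}{\ln\frac{\varepsilon_1\varepsilon_2}{4d^2}}\ln|x-x(s_2)|+E(x)$$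 with $|E(x)|\le K\sqrt{\varepsilon_1^2+\varepsilon_2^2}$ for all $x\in\Omega$ satisfying $\operatorname{dist}(x,\partial\Omega_1\cup\partial\Omega_2)\ge c$. -/

import Mathlib

/-- The point `x(t) = (cos t, sin t)` of the unit circle; the plane `ℝ²` is identified with `ℂ`. -/
noncomputable def circlePt (t : ℝ) : ℂ := ⟨Real.cos t, Real.sin t⟩

/-- The open arc `{x(t) : s - ε < t < s + ε}` of the unit circle with centre `x(s)`
and half-length `ε`. -/
def circleArc (s ε : ℝ) : Set ℂ := circlePt '' Set.Ioo (s - ε) (s + ε)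

/-- `u` is a solution of the mixed boundary value problem of the narrow escape problem (without
drift) in the open unit disk, with absorbing part `A` of the unit circle and reflecting part the
unit circle minus the closure of `A`:
`Δ u = -1` in the disk, `u = 0` on `A`, and `∂u/∂ν = 0` on the reflecting part.
The function is `C²` in the open disk and continuous on the closed disk (continuity at the end
points of the arcs is what makes the solution unique). On the unit circle the outward unit normal
at `x` is `x` itself, so that `∂u/∂ν (x)` is the one-sided derivative of `r ↦ u (r x)` at `r = 1`
from inside. Values of `u` outside the closed disk play no role. -/
structure IsEscapeSolution (A : Set ℂ) (u : ℂ → ℝ) : Prop where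
  contDiffOn : ContDiffOn ℝ 2 u (Metric.ball 0 1)
  continuousOn : ContinuousOn u (Metric.closedBall 0 1)
  laplacian_eq : ∀ x ∈ Metric.ball (0 : ℂ) 1, Laplacian.laplacian u x = -1
  absorbing : ∀ x ∈ A, u x = 0
  reflecting : ∀ x ∈ Metric.sphere (0 : ℂ) 1 \ closure A,
    HasDerivWithinAt (fun r : ℝ => u (r • x)) 0 (Set.Iic 1) 1

/-! ### The mixed problem and superposition of its solutions. -/

open Metric Set Filter Topology
open scoped ComplexConjugate

/-! For a single arc there is an explicit harmonic `g` (`arcSolution`), zero on the arc, with normal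
derivative `1/2` on the rest of the circle, and `g = ln|x - x(s)| - ln(ε/2) + O(ε)` away from the
centre (`abs_arcSolution_sub_le`).

For two arcs, try `v = C + (1 - |x|²)/4 + b₁g₁ + b₂g₂`. The reflecting condition forces `b₁ + b₂ =
1`. With `lᵢ = ln(εᵢ/2) - ln d`, `v` is nearly `C - b₂l₂` on the first arc and `C - b₁l₁` on the
second; making both vanish gives `b₁ = l₂/(l₁+l₂)`, `b₂ = l₁/(l₁+l₂)`, `C = l₁l₂/(l₁+l₂)`. Then `u -
v` is harmonic with zero normal derivative on the reflecting part and is `O(ε₁+ε₂)` on the arcs,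
hence on the whole closed disk by a maximum principle (`IsMixedSolution.abs_le_of_barrier`). The
distance `c` enters only when `gᵢ` is replaced by its logarithm. -/

/-- The mixed problem in the unit disk without its Dirichlet condition: `Δ u = k` in the open disk
and `∂u/∂ν = q` on the unit circle outside the closure of `A`. -/
structure IsMixedSolution (A : Set ℂ) (k q : ℝ) (u : ℂ → ℝ) : Prop where
  contDiffOn : ContDiffOn ℝ 2 u (ball 0 1)
  continuousOn : ContinuousOn u (closedBall 0 1)
  laplacian_eq : ∀ x ∈ ball (0 : ℂ) 1, Laplacian.laplacian u x = k
  reflecting : ∀ x ∈ sphere (0 : ℂ) 1 \ closure A,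
    HasDerivWithinAt (fun r : ℝ => u (r • x)) q (Iic 1) 1

namespace IsMixedSolution

variable {A B : Set ℂ} {k q k' q' : ℝ} {u v : ℂ → ℝ}

theorem contDiffAt (hu : IsMixedSolution A k q u) {x : ℂ} (hx : x ∈ ball (0 : ℂ) 1) :
    ContDiffAt ℝ 2 u x :=
  hu.contDiffOn.contDiffAt (isOpen_ball.mem_nhds hx)

theorem add (hu : IsMixedSolution A k q u) (hv : IsMixedSolution A k' q' v) :
    IsMixedSolution A (k + k') (q + q') (u + v) where
  contDiffOn := hu.contDiffOn.add hv.contDiffOn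
  continuousOn := hu.continuousOn.add hv.continuousOn
  laplacian_eq x hx := by
    rw [(hu.contDiffAt hx).laplacian_add (hv.contDiffAt hx), hu.laplacian_eq x hx,
      hv.laplacian_eq x hx]
  reflecting x hx := (hu.reflecting x hx).add (hv.reflecting x hx)

theorem smul (c : ℝ) (hu : IsMixedSolution A k q u) :
    IsMixedSolution A (c * k) (c * q) (c • u) where
  contDiffOn := contDiffOn_const.smul hu.contDiffOn
  continuousOn := continuousOn_const.smul hu.continuousOn
  laplacian_eq x hx := by
    rw [InnerProductSpace.laplacian_smul c (hu.contDiffAt hx), hu.laplacian_eq x hx, smul_eq_mul]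
  reflecting x hx := (hu.reflecting x hx).const_mul c

theorem mono (h : A ⊆ B) (hu : IsMixedSolution A k q u) : IsMixedSolution B k q u where
  contDiffOn := hu.contDiffOn
  continuousOn := hu.continuousOn
  laplacian_eq := hu.laplacian_eq
  reflecting x hx := hu.reflecting x ⟨hx.1, fun hA => hx.2 (closure_mono h hA)⟩

theorem const (A : Set ℂ) (c : ℝ) : IsMixedSolution A 0 0 (fun _ => c) where
  contDiffOn := contDiffOn_const
  continuousOn := continuousOn_const
  laplacian_eq x hx := by simp
  reflecting x hx := hasDerivWithinAt_const _ _ _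

theorem norm_sq (A : Set ℂ) : IsMixedSolution A 4 2 (fun x => ‖x‖ ^ 2) where
  contDiffOn := (contDiff_norm_sq ℝ).contDiffOn
  continuousOn := by fun_prop
  laplacian_eq x hx := by
    rw [InnerProductSpace.laplacian_eq_iteratedFDeriv_complexPlane]
    simp only [iteratedFDeriv_two_apply, fderiv_norm_sq]
    have : fderiv ℝ ((2 : ℕ) • ⇑(innerSL ℝ (E := ℂ))) x = (2 : ℕ) • innerSL ℝ (E := ℂ) :=
      ((2 : ℕ) • innerSL ℝ (E := ℂ)).fderiv
    rw [this]
    have hi : ∀ y : ℂ, innerSL ℝ y y = ‖y‖ ^ 2 := real_inner_self_eq_norm_sq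
    simp [hi]
    norm_num
  reflecting x hx := by
    have h1 : ‖x‖ = 1 := by simpa using hx.1
    have : (fun r : ℝ => ‖r • x‖ ^ 2) = fun r => r ^ 2 := by
      ext r; rw [norm_smul, h1, mul_one, Real.norm_eq_abs, sq_abs]
    simp only [this]
    simpa using (hasDerivAt_pow 2 (1 : ℝ)).hasDerivWithinAt

end IsMixedSolution

/-! ### Maximum principle for the mixed problem. -/

/-- The second derivative test along a line: at a local maximum the second derivative is `≤ 0`. -/
theorem IsLocalMax.iteratedFDeriv_two_nonpos {f : ℂ → ℝ} {x : ℂ} (hf : ContDiffAt ℝ 2 f x)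
    (h : IsLocalMax f x) (e : ℂ) : iteratedFDeriv ℝ 2 f x ![e, e] ≤ 0 := by
  rw [iteratedFDeriv_two_apply]
  simp only [Matrix.cons_val_zero, Matrix.cons_val_one]
  by_contra! hpos
  set l : ℝ → ℂ := fun t => x + t • e with hl
  have hl0 : l 0 = x := by simp [hl]
  have hlc : Continuous l := by fun_prop
  have hld : ∀ t, HasDerivAt l e t := fun t => by
    simpa [hl] using ((hasDerivAt_id t).smul_const e).const_add x
  have hlt : Tendsto l (𝓝 0) (𝓝 x) := by simpa [hl0] using hlc.tendsto 0
  have hev : ∀ᶠ y in 𝓝 x, DifferentiableAt ℝ f y := by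
    filter_upwards [hf.eventually (by simp)] with y hy using hy.differentiableAt (by simp)
  have hd1 : deriv (f ∘ l) =ᶠ[𝓝 0] fun t => fderiv ℝ f (l t) e := by
    filter_upwards [hlt.eventually hev] with t ht
    exact (ht.hasFDerivAt.comp_hasDerivAt t (hld t)).deriv
  have hd2 : HasDerivAt (fun t => fderiv ℝ f (l t) e) (fderiv ℝ (fderiv ℝ f) x e e) 0 := by
    have hf2 : HasFDerivAt (fderiv ℝ f) (fderiv ℝ (fderiv ℝ f) x) (l 0) := by
      rw [hl0]
      exact ((hf.fderiv_right (m := 1) (by norm_num)).differentiableAt (by simp)).hasFDerivAt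
    have := hf2.comp_hasDerivAt (0 : ℝ) (hld 0)
    exact (ContinuousLinearMap.apply ℝ ℝ e).hasFDerivAt.comp_hasDerivAt (0 : ℝ) this
  have hmax : IsLocalMax (f ∘ l) 0 := by
    have : ∀ᶠ t in 𝓝 (0 : ℝ), f (l t) ≤ f x := hlt.eventually h
    simpa [IsLocalMax, IsMaxFilter, hl0] using this
  have hcont : ContinuousAt (f ∘ l) 0 := by
    refine ContinuousAt.comp ?_ hlc.continuousAt
    rw [hl0]; exact hf.continuousAt
  have hdd : deriv (deriv (f ∘ l)) 0 = fderiv ℝ (fderiv ℝ f) x e e := by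
    rw [hd1.deriv_eq, hd2.deriv]
  -- A positive second derivative would make `0` a local minimum as well, so `f ∘ l` would be
  -- locally constant.
  have hmin : IsLocalMin (f ∘ l) 0 :=
    isLocalMin_of_deriv_deriv_pos (by rw [hdd]; exact hpos) hmax.deriv_eq_zero hcont
  have hconst : (f ∘ l) =ᶠ[𝓝 0] fun _ => (f ∘ l) 0 := by
    filter_upwards [hmax, hmin] with t h1 h2 using le_antisymm h1 h2
  have : deriv (deriv (f ∘ l)) 0 = 0 := by
    rw [hconst.deriv.deriv_eq]; simp
  linarith [hdd]

theorem IsLocalMax.laplacian_nonpos {f : ℂ → ℝ} {x : ℂ} (hf : ContDiffAt ℝ 2 f x)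
    (h : IsLocalMax f x) : Laplacian.laplacian f x ≤ 0 := by
  rw [InnerProductSpace.laplacian_eq_iteratedFDeriv_complexPlane]
  exact add_nonpos (h.iteratedFDeriv_two_nonpos hf 1) (h.iteratedFDeriv_two_nonpos hf Complex.I)

namespace IsMixedSolution

variable {A : Set ℂ} {k q M : ℝ} {u w : ℂ → ℝ}

/-- A strictly subharmonic function with negative normal derivative on the reflecting part attains
its maximum on the closure of the absorbing part. -/
theorem exists_isMaxOn (hu : IsMixedSolution A k q u) (hk : 0 < k) (hq : q < 0) :
    ∃ p ∈ closedBall (0 : ℂ) 1 ∩ closure A, ∀ x ∈ closedBall (0 : ℂ) 1, u x ≤ u p := by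
  obtain ⟨p, hp, hmax⟩ := (isCompact_closedBall (0 : ℂ) 1).exists_isMaxOn
    ⟨0, by simp⟩ hu.continuousOn
  refine ⟨p, ⟨hp, ?_⟩, hmax⟩
  by_contra hpA
  rcases (mem_closedBall.1 hp).lt_or_eq with hlt | heq
  · have hloc : IsLocalMax u p := by
      filter_upwards [isOpen_ball.mem_nhds (mem_ball.2 hlt)] with y hy
      exact hmax (ball_subset_closedBall hy)
    have := hloc.laplacian_nonpos (hu.contDiffAt hlt)
    rw [hu.laplacian_eq p hlt] at this
    linarith
  · have hd := hu.reflecting p ⟨heq, hpA⟩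
    have hp1 : ‖p‖ = 1 := by simpa using heq
    have hloc : IsLocalMaxOn (fun r : ℝ => u (r • p)) (Iic 1) 1 := by
      filter_upwards [self_mem_nhdsWithin, mem_nhdsWithin_of_mem_nhds
        (Ioi_mem_nhds (zero_lt_one' ℝ))] with r hr1 hr0
      simp only [one_smul]
      refine hmax ?_
      rw [mem_closedBall_zero_iff, norm_smul, hp1, mul_one, Real.norm_eq_abs,
        abs_of_pos hr0]
      exact hr1
    -- Moving inward from a boundary maximum cannot increase `u`: `-q ≤ 0`.
    have hc : (-1 : ℝ) ∈ posTangentConeAt (Iic (1 : ℝ)) 1 := by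
      refine mem_posTangentConeAt_of_segment_subset fun y hy => ?_
      rw [segment_symm, segment_eq_Icc (by norm_num)] at hy
      exact hy.2
    have := hloc.hasFDerivWithinAt_nonpos hd.hasFDerivWithinAt hc
    simp at this
    linarith

/-- Adding `δ • u` makes `w` strictly subharmonic with negative normal derivative, so the sum peaks
on `closure A`, where `w ≤ M` by continuity; then `δ → 0`. A strict barrier replaces Hopf's lemma.
-/
theorem le_of_barrier (hA : A ⊆ closedBall 0 1) (hu : IsMixedSolution A k q u) (hk : 0 < k)
    (hq : q < 0) (hw : IsMixedSolution A 0 0 w) (hM : ∀ x ∈ A, w x ≤ M) {x : ℂ}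
    (hx : x ∈ closedBall (0 : ℂ) 1) : w x ≤ M := by
  obtain ⟨N, hN⟩ := (isCompact_closedBall (0 : ℂ) 1).exists_bound_of_continuousOn hu.continuousOn
  have hN0 : 0 ≤ N := (norm_nonneg _).trans (hN x hx)
  have key : ∀ δ : ℝ, 0 < δ → w x ≤ M + δ * (2 * N) := by
    intro δ hδ
    obtain ⟨p, ⟨hp, hpA⟩, hmax⟩ := (hw.add (hu.smul δ)).exists_isMaxOn
      (by simpa using mul_pos hδ hk) (by simpa using mul_neg_of_pos_of_neg hδ hq)
    have hwp : w p ≤ M := by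
      have : (𝓝[A] p).NeBot := mem_closure_iff_nhdsWithin_neBot.1 hpA
      exact le_of_tendsto ((hw.continuousOn p hp).mono hA)
        (eventually_mem_nhdsWithin.mono hM)
    have h1 := hmax x hx
    simp only [Pi.add_apply, Pi.smul_apply, smul_eq_mul] at h1
    have h2 := mul_le_mul_of_nonneg_left (abs_le.1 (hN x hx)).1 hδ.le
    have h3 := mul_le_mul_of_nonneg_left (abs_le.1 (hN p hp)).2 hδ.le
    linarith
  refine le_of_forall_pos_le_add fun η hη => ?_
  have := key (η / (2 * N + 1)) (by positivity)
  have h2 : η / (2 * N + 1) * (2 * N) ≤ η := by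
    rw [div_mul_eq_mul_div, div_le_iff₀ (by positivity)]
    nlinarith
  linarith

theorem abs_le_of_barrier (hA : A ⊆ closedBall 0 1) (hu : IsMixedSolution A k q u) (hk : 0 < k)
    (hq : q < 0) (hw : IsMixedSolution A 0 0 w) (hM : ∀ x ∈ A, |w x| ≤ M) {x : ℂ}
    (hx : x ∈ closedBall (0 : ℂ) 1) : |w x| ≤ M := by
  have hw' : IsMixedSolution A 0 0 ((-1 : ℝ) • w) := by simpa using hw.smul (-1)
  have h1 := le_of_barrier hA hu hk hq hw (fun y hy => (abs_le.1 (hM y hy)).2) hx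
  have h2 := le_of_barrier (M := M) hA hu hk hq hw' (fun y hy => by
    have := (abs_le.1 (hM y hy)).1
    simp only [Pi.smul_apply, smul_eq_mul]; linarith) hx
  simp only [Pi.smul_apply, smul_eq_mul] at h2
  exact abs_le.2 ⟨by linarith, h1⟩

end IsMixedSolution

theorem Complex.re_eq_zero_of_sq_eq_ofReal {w : ℂ} {t : ℝ} (ht : t ≤ 0) (h : w ^ 2 = t) :
    w.re = 0 := by
  have h1 := congrArg Complex.re h
  have h2 := congrArg Complex.im h
  simp only [sq, Complex.mul_re, Complex.mul_im, Complex.ofReal_re, Complex.ofReal_im] at h1 h2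
  have h3 : w.re * w.im = 0 := by linarith
  rcases mul_eq_zero.1 h3 with h | h
  · exact h
  · rw [h] at h1; nlinarith [sq_nonneg w.re]

theorem Real.abs_log_sub_log_le {m a b : ℝ} (hm : 0 < m) (ha : m ≤ a) (hb : m ≤ b) :
    |Real.log a - Real.log b| ≤ |a - b| / m := by
  have key : ∀ a b : ℝ, m ≤ a → m ≤ b → Real.log a - Real.log b ≤ |a - b| / m := by
    intro a b ha hb
    have ha0 := hm.trans_le ha
    have hb0 := hm.trans_le hb
    rw [← Real.log_div ha0.ne' hb0.ne']
    calc Real.log (a / b) ≤ a / b - 1 := Real.log_le_sub_one_of_pos (by positivity)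
      _ = (a - b) / b := by field_simp
      _ ≤ |a - b| / b := by gcongr; exact le_abs_self _
      _ ≤ |a - b| / m := by gcongr
  exact abs_le.2 ⟨by have := key b a hb ha; rw [abs_sub_comm] at this; linarith, key a b ha hb⟩

/-! ### The explicit function for one arc centred at `1`. -/

/-- The polynomial `(z - e^{iε}) (z - e^{-iε})`. -/
noncomputable def arcRadicand (ε : ℝ) (z : ℂ) : ℂ := 1 - 2 * z * Real.cos ε + z ^ 2

/-- The branch in the unit disk of `√((z - e^{iε}) (z - e^{-iε}))` with value `1` at `0`. -/
noncomputable def arcRoot (ε : ℝ) (z : ℂ) : ℂ := arcRadicand ε z ^ (2⁻¹ : ℂ)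

/-- The logarithm of the modulus of this function solves the mixed problem for one arc with
centre `1` and half-length `ε`. -/
noncomputable def arcMap (ε : ℝ) (z : ℂ) : ℂ := 1 - z + arcRoot ε z

section ArcMap

variable {ε : ℝ} {z : ℂ}

theorem arcRadicand_re : (arcRadicand ε z).re = 1 - 2 * z.re * Real.cos ε + z.re ^ 2 - z.im ^ 2 := by
  simp [arcRadicand, sq, -Complex.ofReal_cos]; ring

theorem arcRadicand_im : (arcRadicand ε z).im = 2 * z.im * (z.re - Real.cos ε) := by
  simp [arcRadicand, sq, -Complex.ofReal_cos]; ring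

theorem sq_re_add_sq_im_le_one (hz : ‖z‖ ≤ 1) : z.re ^ 2 + z.im ^ 2 ≤ 1 := by
  have := Complex.sq_norm z
  rw [Complex.normSq_apply] at this
  nlinarith [norm_nonneg z]

theorem sq_re_add_sq_im_eq_one (hz : ‖z‖ = 1) : z.re ^ 2 + z.im ^ 2 = 1 := by
  have := Complex.sq_norm z
  rw [Complex.normSq_apply, hz] at this
  nlinarith

theorem cos_sq_lt_one (hε : 0 < ε) (hε1 : ε < Real.pi) : Real.cos ε ^ 2 < 1 := by
  have := Real.sin_pos_of_pos_of_lt_pi hε hε1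
  nlinarith [Real.sin_sq_add_cos_sq ε]

/-- The radicand is real only for `z` real, where it is `(z - cos ε)² + sin² ε > 0`, or for `Re z =
cos ε`, where it is `1 - |z|²`. So the principal square root causes no cut in the disk. -/
theorem arcRadicand_mem_slitPlane (hε : 0 < ε) (hε1 : ε < Real.pi) (hz : ‖z‖ ≤ 1)
    (h : ‖z‖ < 1 ∨ z.re ≠ Real.cos ε) : arcRadicand ε z ∈ Complex.slitPlane := by
  rw [Complex.mem_slitPlane_iff, arcRadicand_re, arcRadicand_im]
  by_contra! hcon
  obtain ⟨h1, h2⟩ := hcon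
  have hc := cos_sq_lt_one hε hε1
  rcases mul_eq_zero.1 h2 with h3 | h3
  · have h4 : z.im = 0 := by linarith
    rw [h4] at h1
    nlinarith [sq_nonneg (z.re - Real.cos ε)]
  · have h4 : z.re = Real.cos ε := by linarith
    rcases h with h | h
    · have := Complex.sq_norm z
      rw [Complex.normSq_apply] at this
      rw [← h4] at h1
      nlinarith [norm_nonneg z]
    · exact h h4

/-- This weaker form admits the end points of the arc, where the radicand is `0` but the root is
still continuous. -/
theorem arcRadicand_re_nonneg_or (hε : 0 < ε) (hε1 : ε < Real.pi) (hz : ‖z‖ ≤ 1) :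
    0 ≤ (arcRadicand ε z).re ∨ (arcRadicand ε z).im ≠ 0 := by
  by_cases h : z.re = Real.cos ε
  · left
    rw [arcRadicand_re, ← h]
    nlinarith [sq_re_add_sq_im_le_one hz]
  · exact (Complex.mem_slitPlane_iff.1 (arcRadicand_mem_slitPlane hε hε1 hz (.inr h))).imp_left
      le_of_lt

theorem arcRoot_sq : arcRoot ε z ^ 2 = arcRadicand ε z := by
  simp [arcRoot]

theorem arcRoot_re_nonneg : 0 ≤ (arcRoot ε z).re := by
  rw [arcRoot, Complex.cpow_inv_two_re]; positivity

/-- On the circle `1/z` is the conjugate of `z`, so dividing the radicand by `z` leaves a real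
number whose sign separates arc from complement. -/
theorem arcRadicand_of_norm_eq_one (hz : ‖z‖ = 1) :
    arcRadicand ε z = z * ((2 * (z.re - Real.cos ε) : ℝ) : ℂ) := by
  have := sq_re_add_sq_im_eq_one hz
  apply Complex.ext
  · rw [arcRadicand_re, Complex.re_mul_ofReal]; nlinarith
  · rw [arcRadicand_im, Complex.im_mul_ofReal]; ring

/-- In the disk `|1 - z|² ≤ 2 Re(1 - z)`, and the root has nonnegative real part. -/
theorem half_sq_le_arcMap_re (hz : ‖z‖ ≤ 1) : ‖1 - z‖ ^ 2 / 2 ≤ (arcMap ε z).re := by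
  have h := arcRoot_re_nonneg (ε := ε) (z := z)
  rw [Complex.sq_norm, Complex.normSq_apply, arcMap]
  simp only [Complex.add_re, Complex.sub_re, Complex.one_re, Complex.sub_im, Complex.one_im]
  nlinarith [sq_re_add_sq_im_le_one hz]

theorem arcMap_re_pos (hε : 0 < ε) (hε1 : ε < Real.pi) (hz : ‖z‖ ≤ 1) : 0 < (arcMap ε z).re := by
  by_cases h : z = 1
  · subst h
    have h1 : 0 < (arcRadicand ε 1).re := by
      rw [arcRadicand_re]
      simp only [Complex.one_re, Complex.one_im]
      nlinarith [cos_sq_lt_one hε hε1]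
    have : 0 < (arcRoot ε 1).re := by
      rw [arcRoot, Complex.cpow_inv_two_re]
      have := norm_nonneg (arcRadicand ε 1)
      exact Real.sqrt_pos.2 (by linarith)
    simpa [arcMap] using this
  · have : 0 < ‖1 - z‖ := norm_pos_iff.2 (sub_ne_zero.2 (Ne.symm h))
    exact lt_of_lt_of_le (by positivity) (half_sq_le_arcMap_re hz)

theorem arcMap_ne_zero (hε : 0 < ε) (hε1 : ε < Real.pi) (hz : ‖z‖ ≤ 1) : arcMap ε z ≠ 0 := by
  intro h
  have := arcMap_re_pos hε hε1 hz
  simp [h] at this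

theorem continuous_arcRadicand (ε : ℝ) : Continuous (arcRadicand ε) := by
  unfold arcRadicand; fun_prop

theorem continuousAt_arcMap (hε : 0 < ε) (hε1 : ε < Real.pi) (hz : ‖z‖ ≤ 1) :
    ContinuousAt (arcMap ε) z := by
  have h : ContinuousAt (arcRoot ε) z :=
    ContinuousAt.comp (g := fun t : ℂ => t ^ (2⁻¹ : ℂ))
      (Complex.continuousAt_cpow_const_of_re_pos (arcRadicand_re_nonneg_or hε hε1 hz)
        (by norm_num)) (continuous_arcRadicand ε).continuousAt
  exact (continuousAt_const.sub continuousAt_id).add h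

theorem analyticAt_arcMap (hε : 0 < ε) (hε1 : ε < Real.pi) (hz : ‖z‖ < 1) :
    AnalyticAt ℂ (arcMap ε) z := by
  have h : AnalyticAt ℂ (arcRadicand ε) z := by unfold arcRadicand; fun_prop
  exact (analyticAt_const.sub analyticAt_id).add
    (h.cpow analyticAt_const (arcRadicand_mem_slitPlane hε hε1 hz.le (.inl hz)))

theorem hasDerivAt_arcMap (h : arcRadicand ε z ∈ Complex.slitPlane) :
    HasDerivAt (arcMap ε) (-1 + (z - Real.cos ε) / arcRoot ε z) z := by
  have h0 : arcRadicand ε z ≠ 0 := Complex.slitPlane_ne_zero h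
  have hR : arcRoot ε z ≠ 0 := fun h' => h0 (by rw [← arcRoot_sq, h']; simp)
  have h1 : HasDerivAt (arcRadicand ε) (-(2 * Real.cos ε) + 2 * z) z := by
    have ha := (((hasDerivAt_id z).const_mul (2 : ℂ)).mul_const (Real.cos ε : ℂ)).const_sub 1
    have hb := ha.add (hasDerivAt_pow 2 z)
    refine (hb.congr_deriv ?_)
    push_cast; ring
  have h2 := h1.cpow_const (c := (2⁻¹ : ℂ)) h
  have h3 : arcRadicand ε z ^ ((2⁻¹ : ℂ) - 1) = (arcRoot ε z)⁻¹ := by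
    rw [Complex.cpow_sub _ _ h0, Complex.cpow_one]
    change arcRoot ε z / _ = _
    rw [← arcRoot_sq]; field_simp
  rw [h3] at h2
  refine (((hasDerivAt_id z).const_sub 1).add h2).congr_deriv ?_
  field_simp
  ring

/-- The normal derivative of `log ‖arcMap ε z‖` on the circle outside the closed arc is `1/2`. -/
theorem hasDerivAt_log_norm_arcMap (hε : 0 < ε) (hε1 : ε < Real.pi) (hz : ‖z‖ = 1)
    (h : z.re < Real.cos ε) :
    HasDerivAt (fun r : ℝ => Real.log ‖arcMap ε (r • z)‖) (1 / 2) 1 := by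
  have hs := arcRadicand_mem_slitPlane hε hε1 hz.le (.inr h.ne)
  have hR : arcRoot ε z ≠ 0 := fun h' =>
    Complex.slitPlane_ne_zero hs (by rw [← arcRoot_sq, h']; simp)
  have hF := arcMap_ne_zero hε hε1 hz.le
  have hl : HasDerivAt (fun r : ℝ => r • z) z 1 := by
    simpa using (hasDerivAt_id (1 : ℝ)).smul_const z
  have hm : HasDerivAt (arcMap ε) (-1 + (z - Real.cos ε) / arcRoot ε z) ((1 : ℝ) • z) := by
    rw [one_smul]; exact hasDerivAt_arcMap hs
  have hc := HasDerivAt.comp (1 : ℝ) hm hl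
  have hlog := hc.clog_real (by
    rw [Function.comp_apply, one_smul]
    exact Complex.mem_slitPlane_iff.2 (.inl (arcMap_re_pos hε hε1 hz.le)))
  have hre := Complex.reCLM.hasFDerivAt.comp_hasDerivAt (1 : ℝ) hlog
  have hfun : (Complex.reCLM ∘ fun t : ℝ => Complex.log ((arcMap ε ∘ fun r : ℝ => r • z) t)) =
      fun r : ℝ => Real.log ‖arcMap ε (r • z)‖ := by
    ext r; simp [Complex.log_re]
  rw [hfun] at hre
  refine hre.congr_deriv ?_
  -- The normal derivative is the real part of `z F'/F`, with `F = arcMap ε`; the second term here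
  -- is purely imaginary off the arc.
  have halg : (-1 + (z - Real.cos ε) / arcRoot ε z) * z / arcMap ε z
      = 1 / 2 - (1 + z) / arcRoot ε z / 2 := by
    have hsq := arcRoot_sq (ε := ε) (z := z)
    rw [arcRadicand] at hsq
    rw [arcMap] at hF ⊢
    rw [div_eq_iff hF]
    field_simp
    linear_combination (-1) * hsq
  have hre0 : ((1 + z) / arcRoot ε z).re = 0 := by
    have hzz : z * conj z = 1 := by rw [Complex.mul_conj, ← Complex.sq_norm, hz]; simp
    have hzc : z + conj z = (2 * z.re : ℝ) := Complex.add_conj z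
    have hsq : ((1 + z) * conj (arcRoot ε z)) ^ 2
        = (((2 + 2 * z.re) * (2 * (z.re - Real.cos ε)) : ℝ) : ℂ) := by
      rw [mul_pow, ← map_pow, arcRoot_sq, arcRadicand_of_norm_eq_one hz, map_mul,
        Complex.conj_ofReal, ← mul_assoc, Complex.ofReal_mul (2 + 2 * z.re)]
      congr 1
      push_cast at hzc ⊢
      linear_combination (2 + z) * hzz + hzc
    have hle : (2 + 2 * z.re) * (2 * (z.re - Real.cos ε)) ≤ 0 := by
      have := (abs_le.1 ((Complex.abs_re_le_norm z).trans hz.le)).1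
      exact mul_nonpos_of_nonneg_of_nonpos (by linarith) (by linarith)
    have := Complex.re_eq_zero_of_sq_eq_ofReal hle hsq
    rw [div_eq_mul_inv, Complex.inv_def, ← mul_assoc, Complex.re_mul_ofReal, this, zero_mul]
  simp only [Function.comp_apply, one_smul, Complex.reCLM_apply, halg]
  have h2 : (1 + z) / arcRoot ε z / 2 = ((2⁻¹ : ℝ) : ℂ) * ((1 + z) / arcRoot ε z) := by
    push_cast; ring
  rw [Complex.sub_re, h2, Complex.re_ofReal_mul, hre0]
  norm_num

/-- On the closed arc the modulus of `arcMap ε` is constant. -/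
theorem norm_arcMap_sq (hz : ‖z‖ = 1) (h : Real.cos ε ≤ z.re) :
    ‖arcMap ε z‖ ^ 2 = 2 - 2 * Real.cos ε := by
  have hzz : z * conj z = 1 := by rw [Complex.mul_conj, ← Complex.sq_norm, hz]; simp
  have hzc : z + conj z = (2 * z.re : ℝ) := Complex.add_conj z
  -- A nonpositive square: `1 - z` and the root are orthogonal, so the squared norm of their sum is
  -- `(2 - 2 Re z) + 2 (Re z - cos ε)`.
  have hsq : ((1 - z) * conj (arcRoot ε z)) ^ 2
      = (((2 * z.re - 2) * (2 * (z.re - Real.cos ε)) : ℝ) : ℂ) := by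
    rw [mul_pow, ← map_pow, arcRoot_sq, arcRadicand_of_norm_eq_one hz, map_mul,
      Complex.conj_ofReal, ← mul_assoc, Complex.ofReal_mul (2 * z.re - 2)]
    congr 1
    push_cast at hzc ⊢
    linear_combination (z - 2) * hzz + hzc
  have hle : (2 * z.re - 2) * (2 * (z.re - Real.cos ε)) ≤ 0 := by
    have := (Complex.re_le_norm z).trans hz.le
    exact mul_nonpos_of_nonpos_of_nonneg (by linarith) (by linarith)
  have hre := Complex.re_eq_zero_of_sq_eq_ofReal hle hsq
  have hR : Complex.normSq (arcRoot ε z) = 2 * (z.re - Real.cos ε) := by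
    rw [← Complex.sq_norm, ← norm_pow, arcRoot_sq, arcRadicand_of_norm_eq_one hz, norm_mul, hz,
      one_mul, Complex.norm_real, Real.norm_eq_abs, abs_of_nonneg (by linarith)]
  rw [arcMap, Complex.sq_norm, Complex.normSq_add, hre, hR, Complex.normSq_apply]
  simp only [Complex.sub_re, Complex.one_re, Complex.sub_im, Complex.one_im]
  linarith [sq_re_add_sq_im_eq_one hz]

/-- With `R = arcRoot ε z`, `(R - (1 - z)) (R + (1 - z)) = 2z (1 - cos ε)` is `O(ε²)`, and the
second factor is bounded below. -/
theorem norm_arcMap_sub_le (hz : ‖z‖ ≤ 1) (h : 0 < ‖1 - z‖) :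
    ‖arcMap ε z - 2 * (1 - z)‖ ≤ ε ^ 2 / (‖1 - z‖ ^ 2 / 2) := by
  have hF := (half_sq_le_arcMap_re (ε := ε) hz).trans (Complex.re_le_norm _)
  have hprod : (arcMap ε z - 2 * (1 - z)) * arcMap ε z = 2 * z * ((1 - Real.cos ε : ℝ) : ℂ) := by
    have := arcRoot_sq (ε := ε) (z := z)
    rw [arcRadicand] at this
    rw [arcMap]
    push_cast at this ⊢
    linear_combination this
  have hn := congrArg norm hprod
  rw [norm_mul, norm_mul, norm_mul, Complex.norm_real, Real.norm_eq_abs, Complex.norm_ofNat,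
    abs_of_nonneg (sub_nonneg.2 (Real.cos_le_one ε))] at hn
  rw [le_div_iff₀ (by positivity)]
  calc _ ≤ ‖arcMap ε z - 2 * (1 - z)‖ * ‖arcMap ε z‖ := by gcongr
    _ = 2 * ‖z‖ * (1 - Real.cos ε) := hn
    _ ≤ 2 * 1 * (ε ^ 2 / 2) := by
        have := Real.one_sub_sq_div_two_le_cos (x := ε)
        have := Real.cos_le_one ε
        gcongr
        linarith
    _ = ε ^ 2 := by ring

theorem abs_log_two_sub_two_cos_sub_le (hε : 0 < ε) (hε1 : ε ≤ 1) :
    |Real.log (2 - 2 * Real.cos ε) / 2 - Real.log ε| ≤ ε := by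
  have hcos := Real.cos_bound (x := ε) (by rwa [abs_of_pos hε])
  rw [abs_of_pos hε] at hcos
  have h4 : ε ^ 4 ≤ ε ^ 2 := pow_le_pow_of_le_one hε.le hε1 (by norm_num)
  have hd : |2 - 2 * Real.cos ε - ε ^ 2| ≤ ε ^ 4 / 2 := by
    have : 0 ≤ ε ^ 4 := by positivity
    rw [abs_le] at hcos ⊢
    constructor <;> linarith
  have hlo : ε ^ 2 / 2 ≤ 2 - 2 * Real.cos ε := by linarith [(abs_le.1 hd).1]
  have hε2 : 0 < ε ^ 2 := by positivity
  have := Real.abs_log_sub_log_le (m := ε ^ 2 / 2) (by positivity) hlo (by linarith : _ ≤ ε ^ 2)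
  rw [Real.log_pow] at this
  have h5 : |2 - 2 * Real.cos ε - ε ^ 2| / (ε ^ 2 / 2) ≤ ε := by
    rw [div_le_iff₀ (by positivity)]
    have : ε ^ 4 ≤ ε ^ 3 := pow_le_pow_of_le_one hε.le hε1 (by norm_num)
    linarith
  have h6 : Real.log (2 - 2 * Real.cos ε) / 2 - Real.log ε =
      (Real.log (2 - 2 * Real.cos ε) - (2 : ℕ) * Real.log ε) / 2 := by push_cast; ring
  rw [h6, abs_div, abs_two]
  linarith

/-- The far field of the solution of the mixed problem for one arc. -/
theorem abs_log_norm_arcMap_sub_le {c : ℝ} (hc : 0 < c) (hε : 0 < ε) (hε1 : ε ≤ 1) (hz : ‖z‖ ≤ 1)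
    (hcz : c ≤ ‖1 - z‖) :
    |Real.log ‖arcMap ε z‖ - Real.log (2 - 2 * Real.cos ε) / 2
      - (Real.log ‖1 - z‖ - Real.log (ε / 2))| ≤ (4 / c ^ 4 + 1) * ε := by
  have h0 : 0 < ‖1 - z‖ := hc.trans_le hcz
  have hF := (half_sq_le_arcMap_re (ε := ε) hz).trans (Complex.re_le_norm _)
  have h2 : ‖1 - z‖ ≤ 2 := (norm_sub_le _ _).trans (by simpa using by linarith)
  have hm1 : c ^ 2 / 2 ≤ ‖arcMap ε z‖ := le_trans (by gcongr) hF
  have hm2 : c ^ 2 / 2 ≤ 2 * ‖1 - z‖ := by nlinarith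
  have hlog := Real.abs_log_sub_log_le (by positivity) hm1 hm2
  have hdiff : |‖arcMap ε z‖ - 2 * ‖1 - z‖| ≤ ε / (c ^ 2 / 2) := by
    calc |‖arcMap ε z‖ - 2 * ‖1 - z‖| = |‖arcMap ε z‖ - ‖2 * (1 - z)‖| := by simp
      _ ≤ ‖arcMap ε z - 2 * (1 - z)‖ := abs_norm_sub_norm_le _ _
      _ ≤ ε ^ 2 / (‖1 - z‖ ^ 2 / 2) := norm_arcMap_sub_le hz h0
      _ ≤ ε / (c ^ 2 / 2) := by gcongr; nlinarith
  have hlog' : |Real.log ‖arcMap ε z‖ - Real.log (2 * ‖1 - z‖)| ≤ 4 / c ^ 4 * ε := by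
    refine hlog.trans ?_
    calc _ ≤ ε / (c ^ 2 / 2) / (c ^ 2 / 2) := by gcongr
      _ = _ := by field_simp; norm_num
  have hcst := abs_log_two_sub_two_cos_sub_le hε hε1
  rw [Real.log_mul two_ne_zero h0.ne'] at hlog'
  rw [Real.log_div hε.ne' two_ne_zero]
  rw [abs_le] at *
  constructor <;> linarith

end ArcMap

/-! ### Arcs of the circle, and rotation to a general centre. -/

theorem norm_circlePt (t : ℝ) : ‖circlePt t‖ = 1 := by
  have h : ‖circlePt t‖ ^ 2 = 1 := by
    rw [Complex.sq_norm, Complex.normSq_apply, circlePt]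
    linarith [Real.sin_sq_add_cos_sq t]
  exact (pow_eq_one_iff_of_nonneg (norm_nonneg _) two_ne_zero).1 h

theorem continuous_circlePt : Continuous circlePt := by
  have : circlePt = fun t => ((Real.cos t : ℂ) + (Real.sin t : ℂ) * Complex.I) :=
    funext fun t => Complex.mk_eq_add_mul_I _ _
  rw [this]; fun_prop

theorem circlePt_mul_conj_re (t s : ℝ) :
    (circlePt t * conj (circlePt s)).re = Real.cos (t - s) := by
  rw [Real.cos_sub]; simp [circlePt]

theorem circlePt_mul_conj_self (s : ℝ) : circlePt s * conj (circlePt s) = 1 := by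
  rw [Complex.mul_conj, ← Complex.sq_norm, norm_circlePt]; simp

theorem norm_mul_conj_circlePt (x : ℂ) (s : ℝ) : ‖x * conj (circlePt s)‖ = ‖x‖ := by
  rw [norm_mul, RCLike.norm_conj, norm_circlePt, mul_one]

theorem norm_one_sub_mul_conj_circlePt (x : ℂ) (s : ℝ) :
    ‖1 - x * conj (circlePt s)‖ = ‖x - circlePt s‖ := by
  rw [← circlePt_mul_conj_self s, ← sub_mul, norm_mul_conj_circlePt, norm_sub_rev]

theorem norm_circlePt_sub_le (t s : ℝ) : ‖circlePt t - circlePt s‖ ≤ |t - s| := by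
  refine abs_le_of_sq_le_sq' ?_ (abs_nonneg _) |>.2
  have h := Real.one_sub_sq_div_two_le_cos (x := t - s)
  rw [Real.cos_sub] at h
  rw [sq_abs, Complex.sq_norm, Complex.normSq_apply]
  simp only [circlePt, Complex.sub_re, Complex.sub_im]
  nlinarith [Real.sin_sq_add_cos_sq t, Real.sin_sq_add_cos_sq s]

theorem norm_of_mem_circleArc {s ε : ℝ} {x : ℂ} (hx : x ∈ circleArc s ε) : ‖x‖ = 1 := by
  obtain ⟨t, -, rfl⟩ := hx
  exact norm_circlePt t

theorem circlePt_mem_circleArc (s : ℝ) {ε : ℝ} (hε : 0 < ε) : circlePt s ∈ circleArc s ε :=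
  ⟨s, ⟨by linarith, by linarith⟩, rfl⟩

theorem norm_sub_circlePt_le_of_mem_circleArc {s ε : ℝ} {x : ℂ} (hx : x ∈ circleArc s ε) :
    ‖x - circlePt s‖ ≤ ε := by
  obtain ⟨t, ht, rfl⟩ := hx
  refine (norm_circlePt_sub_le t s).trans (abs_le.2 ⟨?_, ?_⟩) <;> linarith [ht.1, ht.2]

theorem cos_le_re_of_mem_circleArc {s ε : ℝ} {x : ℂ} (hε : ε ≤ Real.pi) (hx : x ∈ circleArc s ε) :
    Real.cos ε ≤ (x * conj (circlePt s)).re := by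
  obtain ⟨t, ht, rfl⟩ := hx
  rw [circlePt_mul_conj_re, ← Real.cos_abs (t - s)]
  exact Real.cos_le_cos_of_nonneg_of_le_pi (abs_nonneg _) hε
    (abs_le.2 ⟨by linarith [ht.1], by linarith [ht.2]⟩)

theorem mem_closure_circleArc {s ε : ℝ} {x : ℂ} (hε : 0 < ε) (hx : ‖x‖ = 1)
    (h : Real.cos ε ≤ (x * conj (circlePt s)).re) : x ∈ closure (circleArc s ε) := by
  set z := x * conj (circlePt s) with hz
  have hz1 : ‖z‖ = 1 := by rw [hz, norm_mul_conj_circlePt, hx]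
  have hz0 : z ≠ 0 := fun h0 => by simp [h0] at hz1
  have hzα : z = circlePt z.arg := by
    apply Complex.ext
    · simp [circlePt, Complex.cos_arg hz0, hz1]
    · simp [circlePt, Complex.sin_arg, hz1]
  have hα : |z.arg| ≤ ε := by
    by_contra! hlt
    have := Real.cos_lt_cos_of_nonneg_of_le_pi hε.le (Complex.abs_arg_le_pi z) hlt
    rw [Real.cos_abs, Complex.cos_arg hz0, hz1, div_one] at this
    linarith
  have hxα : x = circlePt (s + z.arg) := by
    have h1 : x = z * circlePt s := by
      rw [hz, mul_assoc, mul_comm (conj _), circlePt_mul_conj_self, mul_one]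
    rw [h1]
    nth_rewrite 1 [hzα]
    apply Complex.ext
    · simp only [circlePt, Complex.mul_re, Real.cos_add]; ring
    · simp only [circlePt, Complex.mul_im, Real.sin_add]; ring
  rw [hxα]
  refine image_closure_subset_closure_image continuous_circlePt (mem_image_of_mem _ ?_)
  rw [closure_Ioo (by linarith)]
  have := abs_le.1 hα
  exact ⟨by linarith, by linarith⟩

/-- The harmonic function in the unit disk that vanishes on the arc with centre `circlePt s` and
half-length `ε` and has normal derivative `1/2` outside the closed arc. -/
noncomputable def arcSolution (s ε : ℝ) (x : ℂ) : ℝ :=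
  Real.log ‖arcMap ε (x * conj (circlePt s))‖ - Real.log (2 - 2 * Real.cos ε) / 2

theorem isMixedSolution_arcSolution (s : ℝ) {ε : ℝ} (hε : 0 < ε) (hε1 : ε < Real.pi) :
    IsMixedSolution (circleArc s ε) 0 (1 / 2) (arcSolution s ε) := by
  have hharm : ∀ x ∈ ball (0 : ℂ) 1,
      InnerProductSpace.HarmonicAt (fun x => Real.log ‖arcMap ε (x * conj (circlePt s))‖) x := by
    intro x hx
    have hx1 : ‖x * conj (circlePt s)‖ < 1 := by rw [norm_mul_conj_circlePt]; simpa using hx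
    have hF : AnalyticAt ℂ (fun x => arcMap ε (x * conj (circlePt s))) x :=
      AnalyticAt.fun_comp (analyticAt_arcMap hε hε1 hx1) (analyticAt_id.mul analyticAt_const)
    exact hF.harmonicAt_log_norm (arcMap_ne_zero hε hε1 hx1.le)
  have h : IsMixedSolution (circleArc s ε) 0 (1 / 2)
      (fun x => Real.log ‖arcMap ε (x * conj (circlePt s))‖) :=
    { contDiffOn := fun x hx => (hharm x hx).1.contDiffWithinAt
      continuousOn := by
        intro x hx
        have hx1 : ‖x * conj (circlePt s)‖ ≤ 1 := by rw [norm_mul_conj_circlePt]; simpa using hx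
        have hF : ContinuousAt (fun x => arcMap ε (x * conj (circlePt s))) x :=
          ContinuousAt.comp (f := fun x => x * conj (circlePt s)) (continuousAt_arcMap hε hε1 hx1)
            (by fun_prop)
        exact (hF.norm.log (norm_ne_zero_iff.2 (arcMap_ne_zero hε hε1 hx1))).continuousWithinAt
      laplacian_eq := fun x hx => (hharm x hx).2.eq_of_nhds
      reflecting := by
        intro x hx
        have hx1 : ‖x‖ = 1 := by simpa using hx.1
        have hre : (x * conj (circlePt s)).re < Real.cos ε := by
          by_contra! hcon
          exact hx.2 (mem_closure_circleArc hε hx1 hcon)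
        have := hasDerivAt_log_norm_arcMap hε hε1 (by rw [norm_mul_conj_circlePt, hx1]) hre
        simpa only [smul_mul_assoc] using this.hasDerivWithinAt }
  have h2 := h.add (IsMixedSolution.const _ (-(Real.log (2 - 2 * Real.cos ε) / 2)))
  rw [add_zero, add_zero] at h2
  exact h2

theorem arcSolution_eq_zero {s ε : ℝ} {x : ℂ} (hε : ε < Real.pi)
    (hx : x ∈ circleArc s ε) : arcSolution s ε x = 0 := by
  have h := norm_arcMap_sq (ε := ε) (by rw [norm_mul_conj_circlePt, norm_of_mem_circleArc hx])
    (cos_le_re_of_mem_circleArc hε.le hx)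
  rw [arcSolution, ← h, Real.log_pow]
  push_cast; ring

theorem abs_arcSolution_sub_le {s ε c : ℝ} {x : ℂ} (hc : 0 < c) (hε : 0 < ε) (hε1 : ε ≤ 1)
    (hx : ‖x‖ ≤ 1) (hcx : c ≤ ‖x - circlePt s‖) :
    |arcSolution s ε x - (Real.log ‖x - circlePt s‖ - Real.log (ε / 2))|
      ≤ (4 / c ^ 4 + 1) * ε := by
  rw [← norm_one_sub_mul_conj_circlePt] at hcx ⊢
  exact abs_log_norm_arcMap_sub_le hc hε hε1 (by rwa [norm_mul_conj_circlePt]) hcx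

/-- Across the other arc the logarithm changes by at most `ε'/c` from its value at the centre, so a
constant can cancel it there. -/
theorem abs_arcSolution_sub_le_of_mem_circleArc {s ε s' ε' c : ℝ} {x : ℂ} (hc : 0 < c)
    (hε : 0 < ε) (hε1 : ε ≤ 1) (hε' : ε' ≤ c) (hd : 2 * c ≤ ‖circlePt s' - circlePt s‖)
    (hx : x ∈ circleArc s' ε') :
    |arcSolution s ε x - (Real.log ‖circlePt s' - circlePt s‖ - Real.log (ε / 2))|
      ≤ (4 / c ^ 4 + 1) * ε + ε' / c := by
  have hxs := norm_sub_circlePt_le_of_mem_circleArc hx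
  have hdiff : |‖x - circlePt s‖ - ‖circlePt s' - circlePt s‖| ≤ ε' :=
    (abs_norm_sub_norm_le _ _).trans (by simpa using hxs)
  have hcx : c ≤ ‖x - circlePt s‖ := by linarith [(abs_le.1 hdiff).1]
  have h1 := abs_arcSolution_sub_le hc hε hε1 (norm_of_mem_circleArc hx).le hcx
  have h2 : |Real.log ‖x - circlePt s‖ - Real.log ‖circlePt s' - circlePt s‖| ≤ ε' / c :=
    (Real.abs_log_sub_log_le hc hcx (by linarith)).trans (by gcongr)
  rw [abs_le] at *
  constructor <;> linarith

/-! ### Two arcs: comparison and conclusion. -/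

/-- The far field of the solution of the mixed problem for two well separated arcs, in terms of
the solutions for the single arcs. -/
theorem IsEscapeSolution.abs_sub_arcSolution_le {s₁ s₂ ε₁ ε₂ c l₁ l₂ : ℝ} {u : ℂ → ℝ} {x : ℂ}
    (hc : 0 < c) (h₁ : 0 < ε₁) (h₁' : ε₁ ≤ 1) (h₁c : ε₁ ≤ c) (h₂ : 0 < ε₂) (h₂' : ε₂ ≤ 1)
    (h₂c : ε₂ ≤ c) (hd : 2 * c ≤ ‖circlePt s₁ - circlePt s₂‖)
    (hl₁ : l₁ = Real.log (ε₁ / 2) - Real.log ‖circlePt s₁ - circlePt s₂‖)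
    (hl₂ : l₂ = Real.log (ε₂ / 2) - Real.log ‖circlePt s₁ - circlePt s₂‖)
    (hl₁' : l₁ < 0) (hl₂' : l₂ < 0)
    (hu : IsEscapeSolution (circleArc s₁ ε₁ ∪ circleArc s₂ ε₂) u) (hx : ‖x‖ ≤ 1) :
    |u x - (l₁ * l₂ / (l₁ + l₂) + 1 / 4 * (1 - ‖x‖ ^ 2)
        + l₂ / (l₁ + l₂) * arcSolution s₁ ε₁ x + l₁ / (l₁ + l₂) * arcSolution s₂ ε₂ x)|
      ≤ (4 / c ^ 4 + 1 + 1 / c) * (ε₁ + ε₂) := by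
  have hπ := Real.pi_gt_three
  set A := circleArc s₁ ε₁ ∪ circleArc s₂ ε₂ with hAdef
  have hL : l₁ + l₂ < 0 := by linarith
  set b₁ := l₂ / (l₁ + l₂) with hb₁
  set b₂ := l₁ / (l₁ + l₂) with hb₂
  have hb₁0 : 0 ≤ b₁ := div_nonneg_of_nonpos hl₂'.le hL.le
  have hb₂0 : 0 ≤ b₂ := div_nonneg_of_nonpos hl₁'.le hL.le
  have hb : b₁ + b₂ = 1 := by
    rw [hb₁, hb₂, ← add_div, add_comm l₂, div_self hL.ne]
  have hA : A ⊆ closedBall 0 1 := by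
    rintro y (hy | hy) <;> simpa using (norm_of_mem_circleArc hy).le
  have g₁ : IsMixedSolution A 0 (1 / 2) (arcSolution s₁ ε₁) :=
    (isMixedSolution_arcSolution s₁ h₁ (by linarith)).mono subset_union_left
  have g₂ : IsMixedSolution A 0 (1 / 2) (arcSolution s₂ ε₂) :=
    (isMixedSolution_arcSolution s₂ h₂ (by linarith)).mono subset_union_right
  have hu' : IsMixedSolution A (-1) 0 u :=
    ⟨hu.contDiffOn, hu.continuousOn, hu.laplacian_eq, hu.reflecting⟩
  -- The barrier `|x|²/8 - g₁` has Laplacian `1/2` and normal derivative `1/4 - 1/2 = -1/4`.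
  have hbar := (g₁.smul (-1)).add ((IsMixedSolution.norm_sq A).smul (1 / 8))
  have hw := (((hu'.add ((IsMixedSolution.norm_sq A).smul (1 / 4))).add (g₁.smul (-b₁))).add
    (g₂.smul (-b₂))).add (IsMixedSolution.const A (-(l₁ * l₂ / (l₁ + l₂)) - 1 / 4))
  rw [show (-1 : ℝ) + 1 / 4 * 4 + -b₁ * 0 + -b₂ * 0 + 0 = 0 by ring,
    show (0 : ℝ) + 1 / 4 * 2 + -b₁ * (1 / 2) + -b₂ * (1 / 2) + 0 = 0 by linarith] at hw
  have hc4 : 0 ≤ 4 / c ^ 4 + 1 := by positivity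
  have hbound : ∀ b p q g : ℝ, 0 ≤ b → b ≤ 1 → 0 ≤ p → 0 ≤ q →
      |g| ≤ (4 / c ^ 4 + 1) * p + q / c → |-b * g| ≤ (4 / c ^ 4 + 1 + 1 / c) * (q + p) := by
    intro b p q g hb hb1 hp hq hg
    rw [abs_mul, abs_neg, abs_of_nonneg hb]
    have h1 : b * |g| ≤ |g| := mul_le_of_le_one_left (abs_nonneg _) hb1
    have h2 : 0 ≤ (4 / c ^ 4 + 1) * q := by positivity
    have h3 : 0 ≤ p / c := by positivity
    have h4 : (4 / c ^ 4 + 1 + 1 / c) * (q + p)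
      = (4 / c ^ 4 + 1) * q + (4 / c ^ 4 + 1) * p + q / c + p / c := by ring
    linarith
  have key := IsMixedSolution.abs_le_of_barrier (M := (4 / c ^ 4 + 1 + 1 / c) * (ε₁ + ε₂)) hA hbar
    (by norm_num) (by norm_num) hw ?_ (mem_closedBall_zero_iff.2 hx)
  · simp only [Pi.add_apply, Pi.smul_apply, smul_eq_mul] at key
    refine le_trans (le_of_eq (congrArg _ ?_)) key
    ring
  · rintro y (hy | hy)
    -- Here `u` and `g₁` vanish and `C = b₂l₂`, so the error is `-b₂ (g₂ + l₂)`; the other arc is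
    -- symmetric.
    · have hy0 := hu.absorbing y (.inl hy)
      have hg := abs_arcSolution_sub_le_of_mem_circleArc hc h₂ h₂' h₁c hd hy
      simp only [Pi.add_apply, Pi.smul_apply, smul_eq_mul, hy0, norm_of_mem_circleArc hy,
        arcSolution_eq_zero (by linarith) hy]
      refine le_trans (le_of_eq (congrArg _ ?_))
        (hbound b₂ ε₂ ε₁ _ hb₂0 (by linarith) h₂.le h₁.le hg)
      have : l₁ * l₂ / (l₁ + l₂) = b₂ * l₂ := by rw [hb₂]; ring
      rw [this, hl₂]; ring
    · have hy0 := hu.absorbing y (.inr hy)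
      have hg := abs_arcSolution_sub_le_of_mem_circleArc (s := s₁) hc h₁ h₁' h₂c
        (by rwa [norm_sub_rev]) hy
      rw [norm_sub_rev (circlePt s₂)] at hg
      simp only [Pi.add_apply, Pi.smul_apply, smul_eq_mul, hy0, norm_of_mem_circleArc hy,
        arcSolution_eq_zero (by linarith) hy]
      rw [add_comm ε₁]
      refine le_trans (le_of_eq (congrArg _ ?_))
        (hbound b₁ ε₁ ε₂ _ hb₁0 (by linarith) h₁.le h₂.le hg)
      have : l₁ * l₂ / (l₁ + l₂) = b₁ * l₁ := by rw [hb₁]; ring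
      rw [this, hl₁]; ring

theorem theorem3p3 (c₀ : ℝ) (hc₀ : 0 < c₀) :
    ∃ ε₀ : ℝ, 0 < ε₀ ∧ ∀ c : ℝ, 0 < c → ∃ K : ℝ,
      ∀ s₁ s₂ ε₁ ε₂ : ℝ, 0 < ε₁ → ε₁ < ε₀ → 0 < ε₂ → ε₂ < ε₀ →
        c₀ ≤ ‖circlePt s₁ - circlePt s₂‖ →
        ∀ u : ℂ → ℝ, IsEscapeSolution (circleArc s₁ ε₁ ∪ circleArc s₂ ε₂) u →
          ∀ x ∈ Metric.ball (0 : ℂ) 1,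
            c ≤ Metric.infDist x (circleArc s₁ ε₁ ∪ circleArc s₂ ε₂) →
            |u x -
              (((Real.log ‖circlePt s₁ - circlePt s₂‖) ^ 2
                    - Real.log (ε₁ / 2) * Real.log (ε₂ / 2)) /
                  Real.log (ε₁ * ε₂ / (4 * ‖circlePt s₁ - circlePt s₂‖ ^ 2))
                + 1 / 4 * (1 - ‖x‖ ^ 2)
                + Real.log (ε₂ / (2 * ‖circlePt s₁ - circlePt s₂‖)) /
                    Real.log (ε₁ * ε₂ / (4 * ‖circlePt s₁ - circlePt s₂‖ ^ 2)) *
                  Real.log ‖x - circlePt s₁‖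
                + Real.log (ε₁ / (2 * ‖circlePt s₁ - circlePt s₂‖)) /
                    Real.log (ε₁ * ε₂ / (4 * ‖circlePt s₁ - circlePt s₂‖ ^ 2)) *
                  Real.log ‖x - circlePt s₂‖)|
              ≤ K * Real.sqrt (ε₁ ^ 2 + ε₂ ^ 2) := by
  -- The bound `c₀/2` keeps each arc at distance at least `c₀/2` from the other centre and makes
  -- `ln(εᵢ/(2d))` negative. The factor `2` in `K` comes from `ε₁ + ε₂ ≤ 2√(ε₁² + ε₂²)`.
  refine ⟨min 1 (c₀ / 2), by positivity, fun c hc =>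
    ⟨2 * ((4 / (c₀ / 2) ^ 4 + 1 + 1 / (c₀ / 2)) + (4 / c ^ 4 + 1)), ?_⟩⟩
  intro s₁ s₂ ε₁ ε₂ h₁ h₁lt h₂ h₂lt hd u hu x hx hcx
  obtain ⟨h₁', h₁c⟩ := lt_min_iff.1 h₁lt
  obtain ⟨h₂', h₂c⟩ := lt_min_iff.1 h₂lt
  have hx1 : ‖x‖ ≤ 1 := (mem_ball_zero_iff.1 hx).le
  set d := ‖circlePt s₁ - circlePt s₂‖ with hddef
  have hd0 : 0 < d := hc₀.trans_le hd
  have hlog : ∀ ε, 0 < ε → Real.log (ε / (2 * d)) = Real.log (ε / 2) - Real.log d := by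
    intro ε hε
    rw [← div_div, Real.log_div (by positivity) hd0.ne']
  have hneg : ∀ ε, 0 < ε → ε < c₀ / 2 → Real.log (ε / 2) - Real.log d < 0 := by
    intro ε hε hεc
    rw [← hlog ε hε]
    exact Real.log_neg (by positivity) ((div_lt_one (by positivity)).2 (by linarith))
  have hL : Real.log (ε₁ * ε₂ / (4 * d ^ 2))
      = (Real.log (ε₁ / 2) - Real.log d) + (Real.log (ε₂ / 2) - Real.log d) := by
    rw [← hlog ε₁ h₁, ← hlog ε₂ h₂, ← Real.log_mul (by positivity) (by positivity)]
    congr 1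
    field_simp
    norm_num
  rw [hL, hlog ε₁ h₁, hlog ε₂ h₂]
  have hw := hu.abs_sub_arcSolution_le (c := c₀ / 2) (by positivity) h₁ h₁'.le h₁c.le h₂ h₂'.le
    h₂c.le (by linarith) rfl rfl (hneg ε₁ h₁ h₁c) (hneg ε₂ h₂ h₂c) hx1
  rw [← hddef] at hw
  have hl₁ := hneg ε₁ h₁ h₁c
  have hl₂ := hneg ε₂ h₂ h₂c
  have hfar₁ : c ≤ ‖x - circlePt s₁‖ := by
    rw [← dist_eq_norm]
    exact hcx.trans (infDist_le_dist_of_mem (.inl (circlePt_mem_circleArc s₁ h₁)))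
  have hfar₂ : c ≤ ‖x - circlePt s₂‖ := by
    rw [← dist_eq_norm]
    exact hcx.trans (infDist_le_dist_of_mem (.inr (circlePt_mem_circleArc s₂ h₂)))
  have hg₁ := abs_arcSolution_sub_le hc h₁ h₁'.le hx1 hfar₁
  have hg₂ := abs_arcSolution_sub_le hc h₂ h₂'.le hx1 hfar₂
  generalize Real.log (ε₁ / 2) = a₁ at *
  generalize Real.log (ε₂ / 2) = a₂ at *
  generalize Real.log d = D at *
  have hLneg : a₁ - D + (a₂ - D) < 0 := by linarith
  set b₁ := (a₂ - D) / (a₁ - D + (a₂ - D)) with hb₁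
  set b₂ := (a₁ - D) / (a₁ - D + (a₂ - D)) with hb₂
  have hb₁0 : 0 ≤ b₁ := div_nonneg_of_nonpos hl₂.le hLneg.le
  have hb₂0 : 0 ≤ b₂ := div_nonneg_of_nonpos hl₁.le hLneg.le
  have hb : b₁ + b₂ = 1 := by rw [hb₁, hb₂, ← add_div, add_comm (a₂ - D), div_self hLneg.ne]
  -- The stated constant is `C` together with the terms `-bᵢ ln(εᵢ/2)` from the far fields of the
  -- `gᵢ`.
  have hconst : (D ^ 2 - a₁ * a₂) / (a₁ - D + (a₂ - D))
      = (a₁ - D) * (a₂ - D) / (a₁ - D + (a₂ - D)) - b₁ * a₁ - b₂ * a₂ := by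
    rw [hb₁, hb₂, div_mul_eq_mul_div, div_mul_eq_mul_div, ← sub_div, ← sub_div]
    congr 1
    ring
  have hs₁ : ε₁ ≤ Real.sqrt (ε₁ ^ 2 + ε₂ ^ 2) := Real.le_sqrt_of_sq_le (by nlinarith)
  have hs₂ : ε₂ ≤ Real.sqrt (ε₁ ^ 2 + ε₂ ^ 2) := Real.le_sqrt_of_sq_le (by nlinarith)
  have hscale : ∀ b g p : ℝ, 0 ≤ b → b ≤ 1 → |g| ≤ p → |b * g| ≤ p := by
    intro b g p hb0 hb1 hg
    rw [abs_mul, abs_of_nonneg hb0]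
    exact (mul_le_of_le_one_left (abs_nonneg _) hb1).trans hg
  have he₁ := hscale b₁ _ _ hb₁0 (by linarith) hg₁
  have he₂ := hscale b₂ _ _ hb₂0 (by linarith) hg₂
  rw [hconst]
  refine le_trans (le_of_eq (congrArg _ ?_)) ((abs_add_three _ _ _).trans
    ((add_le_add (add_le_add hw he₁) he₂).trans ?_))
  · ring
  · have hsum : ε₁ + ε₂ ≤ 2 * Real.sqrt (ε₁ ^ 2 + ε₂ ^ 2) := by linarith
    calc _ = ((4 / (c₀ / 2) ^ 4 + 1 + 1 / (c₀ / 2)) + (4 / c ^ 4 + 1)) * (ε₁ + ε₂) := by ring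
      _ ≤ ((4 / (c₀ / 2) ^ 4 + 1 + 1 / (c₀ / 2)) + (4 / c ^ 4 + 1))
          * (2 * Real.sqrt (ε₁ ^ 2 + ε₂ ^ 2)) := by gcongr
      _ = _ := by ring
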